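/- Let $S$ be a nonnegative random variable and let $S_1,S_2,\ldots$ be i.i.d. copies of $S$. For $t\ge 0$ let $N_o(t)=\#\{n\ge 1: S_1+\cdots+S_n\le t\}$ be the counting process of the ordinary renewal process with renewal distribution $S$. Suppose that $\mathbb{E}[S]=1$ and that $\mathbb{E}[S^r]<\infty$ for some real $r\ge 2$. Then for all real $t\ge 1$ and $\theta>0$, $N_o(t)$ is almost surely finite and $$\mathbb{E}\big[|N_o(t)-t|^r\big]\;\le\; e^{\theta}\,\mathbb{E}[S^r]\left(\frac{10^5\, r^2}{1-\mathbb{E}[e^{-\theta S}]}\right)^{r+1} t^{r/2}.$$ -/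

import Mathlib

open MeasureTheory ProbabilityTheory

/-- `X 0, X 1, X 2, …` are the successive inter-event times of an ordinary renewal process whose
renewal distribution is the law of the nonnegative random variable `S`: they are i.i.d. copies of
`S`. (`X i` is the `(i+1)`-st interval; an atom of `S` at `0` is allowed.) -/
structure IsOrdinaryRenewal {Ω Ω' : Type*} [MeasurableSpace Ω] [MeasurableSpace Ω']
    (X : ℕ → Ω → ℝ) (μ : Measure Ω) (S : Ω' → ℝ) (ν : Measure Ω') : Prop where
  measurable : ∀ i, Measurable (X i)
  indep : iIndepFun X μ
  identDistrib : ∀ i, IdentDistrib (X i) S μ ν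
  nonneg : ∀ᵐ ω ∂ν, 0 ≤ S ω

/-- The time of the `n`-th renewal (with value `0` for `n = 0`). -/
noncomputable def renewalEpoch {Ω : Type*} (X : ℕ → Ω → ℝ) (n : ℕ) (ω : Ω) : ℝ :=
  ∑ i ∈ Finset.range n, X i ω

/-- The counting process: the number of renewals (the `n`-th ones with `n ≥ 1`) in `[0, t]`. -/
noncomputable def renewalCount {Ω : Type*} (X : ℕ → Ω → ℝ) (t : ℝ) (ω : Ω) : ℕ∞ :=
  {n : ℕ | 1 ≤ n ∧ renewalEpoch X n ω ≤ t}.encard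

/-! Split `|N - t|` into the deficit (`N < t`) and the excess (`N > t`).

Deficit: freeze the centred walk `S_n - n` at the first passage of `S_n` above `t`. If `N < t`, then
by time `⌈t⌉` it has frozen at `S_{N+1} - (N+1) > t - N - 1`. Freezing replaces a maximal
inequality: one deterministic time suffices. The frozen walk is a martingale, and induction on a
second-order expansion of `|x + y| ^ r` bounds its `r`-th moment by `(2r)^r n^(r/2)` times a bound
on `E|S - 1|^r` (`integral_stoppedWalk_rpow_le`).

Excess: `N ≥ n` means `S_n ≤ t`, so Chernoff bounds apply. Put `v = E[S²]`, `M = E[S^r]`. If `v ≤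
t`, the quadratic bound on the Laplace transform gives an exponential tail at scale `√(vt)`, and
`v^(r/2) ≤ M`. If `t ≤ v`, the parameter `θ/t` gives `P(N ≥ n) ≤ e^θ exp(-np/t)` with `p = 1 -
E[e^(-θS)]`; the resulting factor `t^r` is at most `M t^(r/2)`. Only this regime needs `θ` and `p`.
-/

namespace Renewal

/-! ### Elementary inequalities -/

theorem exp_neg_le_quadratic {x : ℝ} (hx : 0 ≤ x) : Real.exp (-x) ≤ 1 - x + x ^ 2 / 2 := by
  have h1 := Real.quadratic_le_exp_of_nonneg hx
  have h2 : Real.exp (-x) * Real.exp x = 1 := by rw [← Real.exp_add]; simp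
  have h3 : 0 < Real.exp (-x) := Real.exp_pos _
  by_contra! h
  have h4 : 0 < 1 - x + x ^ 2 / 2 := by nlinarith [sq_nonneg (x - 1)]
  have h5 : (1 - x + x ^ 2 / 2) * (1 + x + x ^ 2 / 2) < Real.exp (-x) * Real.exp x :=
    mul_lt_mul h h1 (by positivity) h3.le
  -- The product of the two quadratics is `1 + x ^ 4 / 4`, which is at least `1`.
  nlinarith [sq_nonneg (x ^ 2)]

/-- The tangent line inequality for `x ↦ x ^ (q + 1)` on the nonnegative half-line. -/
theorem rpow_tangent_le {q a x : ℝ} (hq : 0 ≤ q) (ha : 0 ≤ a) (hx : 0 ≤ x) :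
    (q + 1) * a ^ q * x ≤ q * a ^ (q + 1) + x ^ (q + 1) := by
  have hq1 : 0 < q + 1 := by linarith
  have h := Real.geom_mean_le_arith_mean2_weighted (w₁ := q / (q + 1)) (w₂ := 1 / (q + 1))
    (p₁ := a ^ (q + 1)) (p₂ := x ^ (q + 1)) (by positivity) (by positivity) (by positivity)
    (by positivity) (by field_simp)
  rw [← Real.rpow_mul ha, ← Real.rpow_mul hx, mul_div_cancel₀ _ hq1.ne',
    mul_div_cancel₀ _ hq1.ne', Real.rpow_one] at h
  have h' := mul_le_mul_of_nonneg_left h hq1.le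
  calc (q + 1) * a ^ q * x = (q + 1) * (a ^ q * x) := by ring
    _ ≤ _ := h'
    _ = _ := by field_simp

theorem rpow_add_one_eq {q a : ℝ} (hq : 0 ≤ q) (ha : 0 ≤ a) : a ^ (q + 1) = a ^ q * a := by
  rw [Real.rpow_add_of_nonneg ha hq zero_le_one, Real.rpow_one]

/-- A mean value inequality: `z * |z| ^ q` has derivative `(q + 1) * |z| ^ q`. Oddness reduces pairs
of equal sign to nonnegative ones; across zero the smaller slope `m ^ q` already suffices. -/
theorem signed_rpow_sub_le {q a b m : ℝ} (hq : 0 ≤ q) (hab : b ≤ a) (ha : |a| ≤ m)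
    (hb : |b| ≤ m) : a * |a| ^ q - b * |b| ^ q ≤ (q + 1) * m ^ q * (a - b) := by
  have hm : 0 ≤ m := (abs_nonneg a).trans ha
  have hmq : 0 ≤ m ^ q := by positivity
  have haq : |a| ^ q ≤ m ^ q := Real.rpow_le_rpow (abs_nonneg _) ha hq
  have hbq : |b| ^ q ≤ m ^ q := Real.rpow_le_rpow (abs_nonneg _) hb hq
  have key : ∀ x y : ℝ, 0 ≤ y → y ≤ x → x ^ q ≤ m ^ q →
      x * x ^ q - y * y ^ q ≤ (q + 1) * m ^ q * (x - y) := by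
    intro x y hy hxy hx
    have h := rpow_tangent_le hq (hy.trans hxy) hy
    rw [rpow_add_one_eq hq (hy.trans hxy), rpow_add_one_eq hq hy] at h
    have : (q + 1) * x ^ q * (x - y) ≤ (q + 1) * m ^ q * (x - y) := by
      have : 0 ≤ x - y := by linarith
      gcongr
    nlinarith
  rcases le_total 0 b with h0 | h0
  · rw [abs_of_nonneg h0, abs_of_nonneg (h0.trans hab)] at *
    exact key a b h0 hab haq
  rcases le_total 0 a with h1 | h1
  · have e1 : a * |a| ^ q ≤ a * m ^ q := by gcongr
    have e2 : -b * |b| ^ q ≤ -b * m ^ q := by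
      have : 0 ≤ -b := by linarith
      gcongr
    have e3 : 0 ≤ q * m ^ q * (a - b) := by
      have : 0 ≤ a - b := by linarith
      positivity
    nlinarith
  · rw [abs_of_nonpos h0] at hb hbq ⊢
    rw [abs_of_nonpos h1] at ha haq ⊢
    have := key (-b) (-a) (by linarith) (by linarith) hbq
    linarith

/-- If `b ≤ a / (r - 1)`, then `(1 + 1/(r - 1)) ^ (r - 2) ≤ e`; otherwise `a + b ≤ r * b`. Keeping
the first coefficient absolute matters: a factor like `2 ^ r` there would end up raised to the power
`r / 2` in the moment recursion. -/
theorem add_rpow_le {r a b : ℝ} (hr : 2 ≤ r) (ha : 0 ≤ a) (hb : 0 ≤ b) :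
    (a + b) ^ (r - 2) ≤ 3 * a ^ (r - 2) + r ^ (r - 2) * b ^ (r - 2) := by
  have hq : 0 ≤ r - 2 := by linarith
  have h1 : 0 ≤ a ^ (r - 2) := by positivity
  have h2 : 0 ≤ r ^ (r - 2) * b ^ (r - 2) := by positivity
  rcases le_total (b * (r - 1)) a with h | h
  · have h3 : a + b ≤ a * Real.exp (1 / (r - 1)) := by
      have h4 : b ≤ a * (1 / (r - 1)) := by
        rw [mul_one_div, le_div_iff₀ (by linarith)]; exact h
      nlinarith [Real.add_one_le_exp (1 / (r - 1))]
    calc (a + b) ^ (r - 2) ≤ (a * Real.exp (1 / (r - 1))) ^ (r - 2) := by gcongr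
      _ = Real.exp (1 / (r - 1) * (r - 2)) * a ^ (r - 2) := by
          rw [Real.mul_rpow ha (Real.exp_pos _).le, ← Real.exp_mul, mul_comm]
      _ ≤ Real.exp 1 * a ^ (r - 2) := by
          gcongr
          rw [one_div_mul_eq_div, div_le_one (by linarith)]; linarith
      _ ≤ 3 * a ^ (r - 2) := by
          gcongr
          linarith [Real.exp_one_lt_d9]
      _ ≤ _ := by linarith
  · calc (a + b) ^ (r - 2) ≤ (r * b) ^ (r - 2) := by
          gcongr; linarith
      _ = r ^ (r - 2) * b ^ (r - 2) := Real.mul_rpow (by linarith) hb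
      _ ≤ _ := by linarith

/-- A second order Taylor bound for `x ↦ |x| ^ r`, with a polynomial constant in front of the
quadratic term. -/
theorem abs_add_rpow_le {r : ℝ} (hr : 2 ≤ r) (x y : ℝ) :
    |x + y| ^ r ≤ |x| ^ r + r * (x * |x| ^ (r - 2)) * y + 3 * r ^ 2 * (|x| ^ (r - 2) * y ^ 2)
      + r ^ r * |y| ^ r := by
  have hq : 0 ≤ r - 2 := by linarith
  have hq1 : 0 ≤ r - 1 := by linarith
  have r0 : 0 < r := by linarith
  set u := x + y with hu
  have e1 : ∀ z : ℝ, 0 ≤ z → z ^ r = z ^ (r - 2) * z ^ 2 := by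
    intro z hz
    rw [← Real.rpow_natCast z 2, ← Real.rpow_add_of_nonneg hz hq (by norm_num)]
    norm_num
  have e2 : ∀ z : ℝ, 0 ≤ z → z ^ (r - 1) = z ^ (r - 2) * z := by
    intro z hz
    rw [← rpow_add_one_eq hq hz]; congr 1; ring
  -- Convexity, with the tangent taken at the endpoint `u`; the next step moves the derivative back
  -- from `u` to `x`.
  have hconv : |u| ^ r - |x| ^ r ≤ r * (u * |u| ^ (r - 2)) * y := by
    have h := rpow_tangent_le hq1 (abs_nonneg u) (abs_nonneg x)
    rw [sub_add_cancel, e2 _ (abs_nonneg u)] at h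
    have h1 : u * x ≤ |u| * |x| := by rw [← abs_mul]; exact le_abs_self _
    have h2 : r * |u| ^ (r - 2) * (u * x) ≤ r * |u| ^ (r - 2) * (|u| * |x|) := by gcongr
    have h3 := e1 _ (abs_nonneg u)
    rw [sq_abs] at h3
    have h4 : y = u - x := by rw [hu]; ring
    rw [h4]
    nlinarith
  have hlip : (u * |u| ^ (r - 2) - x * |x| ^ (r - 2)) * y
      ≤ (r - 1) * (|x| + |y|) ^ (r - 2) * y ^ 2 := by
    have hum : |u| ≤ |x| + |y| := abs_add_le _ _
    have hxm : |x| ≤ |x| + |y| := by linarith [abs_nonneg y]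
    rcases le_total 0 y with h | h
    · have := signed_rpow_sub_le hq (show x ≤ u by linarith) hum hxm
      have := mul_le_mul_of_nonneg_right this h
      rw [hu] at this ⊢
      nlinarith
    · have := signed_rpow_sub_le hq (show u ≤ x by linarith) hxm hum
      have := mul_le_mul_of_nonneg_right this (neg_nonneg.2 h)
      rw [hu] at this ⊢
      nlinarith
  have hsplit := add_rpow_le hr (abs_nonneg x) (abs_nonneg y)
  have hA : 0 ≤ |x| ^ (r - 2) * y ^ 2 := by positivity
  have hfin : r * ((r - 1) * (|x| + |y|) ^ (r - 2) * y ^ 2)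
      ≤ 3 * r ^ 2 * (|x| ^ (r - 2) * y ^ 2) + r ^ r * |y| ^ r := by
    have h5 := e1 _ (abs_nonneg y)
    rw [sq_abs] at h5
    rw [h5, e1 r r0.le]
    calc r * ((r - 1) * (|x| + |y|) ^ (r - 2) * y ^ 2)
        ≤ r * (r * (3 * |x| ^ (r - 2) + r ^ (r - 2) * |y| ^ (r - 2)) * y ^ 2) := by
          gcongr; linarith
      _ = _ := by ring
  have := mul_le_mul_of_nonneg_left hlip r0.le
  nlinarith

theorem abs_sub_one_rpow_le {r x : ℝ} (hr : 0 ≤ r) (hx : 0 ≤ x) : |x - 1| ^ r ≤ x ^ r + 1 := by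
  have hxr : 0 ≤ x ^ r := by positivity
  rcases le_total x 1 with h | h
  · have : |x - 1| ^ r ≤ 1 :=
      Real.rpow_le_one (abs_nonneg _) (by rw [abs_le]; constructor <;> linarith) hr
    linarith
  · have : |x - 1| ^ r ≤ x ^ r :=
      Real.rpow_le_rpow (abs_nonneg _) (by rw [abs_of_nonneg] <;> linarith) hr
    linarith

theorem add_one_rpow_le {r x : ℝ} (hr : 0 ≤ r) (hx : 0 ≤ x) :
    (x + 1) ^ r ≤ 2 ^ r * (x ^ r + 1) := by
  have hxr : 0 ≤ x ^ r := by positivity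
  have h2 : (0 : ℝ) ≤ 2 ^ r := by positivity
  rcases le_total x 1 with h | h
  · have : (x + 1) ^ r ≤ 2 ^ r := by gcongr; linarith
    nlinarith
  · have : (x + 1) ^ r ≤ (2 * x) ^ r := by gcongr; linarith
    rw [Real.mul_rpow (by norm_num) hx] at this
    nlinarith

theorem rpow_le_mul_exp {r c x : ℝ} (hr : 0 < r) (hc : 0 < c) (hx : 0 ≤ x) :
    x ^ r ≤ (r / c) ^ r * Real.exp (c * x) := by
  have h : c * x / r ≤ Real.exp (c * x / r) := by linarith [Real.add_one_le_exp (c * x / r)]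
  have h1 : (c * x / r) ^ r ≤ Real.exp (c * x) := by
    calc (c * x / r) ^ r ≤ Real.exp (c * x / r) ^ r := by gcongr
      _ = _ := by rw [← Real.exp_mul]; field_simp
  calc x ^ r = (r / c * (c * x / r)) ^ r := by congr 1; field_simp
    _ = (r / c) ^ r * (c * x / r) ^ r := Real.mul_rpow (by positivity) (by positivity)
    _ ≤ _ := by gcongr

/-- One step of the recursion that gives the growth rate of the `r`-th moment. -/
theorem moment_recursion_step {r : ℝ} (hr : 2 ≤ r) (n : ℕ) {b : ℝ} (hb : 0 ≤ b) {f : ℝ}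
    (hf0 : 0 ≤ f) (hf : f ≤ (2 * r) ^ r * (n : ℝ) ^ (r / 2) * b) :
    f + 3 * r ^ 2 * (f ^ ((r - 2) / r) * b ^ (2 / r)) + r ^ r * b ≤
      (2 * r) ^ r * ((n + 1 : ℕ) : ℝ) ^ (r / 2) * b := by
  have r0 : 0 < r := by linarith
  have hn : (0 : ℝ) ≤ n := n.cast_nonneg
  have hq : 0 ≤ (r - 2) / r := div_nonneg (by linarith) r0.le
  have h1 : f ^ ((r - 2) / r) * b ^ (2 / r) ≤ (2 * r) ^ (r - 2) * (n : ℝ) ^ (r / 2 - 1) * b := by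
    calc f ^ ((r - 2) / r) * b ^ (2 / r)
        ≤ ((2 * r) ^ r * (n : ℝ) ^ (r / 2) * b) ^ ((r - 2) / r) * b ^ (2 / r) := by gcongr
      _ = (2 * r) ^ (r - 2) * (n : ℝ) ^ (r / 2 - 1) * (b ^ ((r - 2) / r) * b ^ (2 / r)) := by
          rw [Real.mul_rpow (by positivity) hb, Real.mul_rpow (by positivity) (by positivity),
            ← Real.rpow_mul (by positivity), ← Real.rpow_mul hn]
          rw [show r * ((r - 2) / r) = r - 2 by field_simp,
            show r / 2 * ((r - 2) / r) = r / 2 - 1 by field_simp]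
          ring
      _ = _ := by
          rw [← Real.rpow_add_of_nonneg hb hq (by positivity),
            show (r - 2) / r + 2 / r = 1 by field_simp; ring, Real.rpow_one]
  -- The constant `K = (2 * r) ^ r` makes the quadratic coefficient exactly `3/4 * K` and leaves `r
  -- ^ r ≤ K / 4` for the last term.
  have h2 : (2 * r) ^ r = (2 * r) ^ (r - 2) * (4 * r ^ 2) := by
    rw [show (4 * r ^ 2 : ℝ) = (2 * r) ^ 2 by ring, ← Real.rpow_natCast (2 * r) 2,
      ← Real.rpow_add (by positivity)]
    norm_num
  have h3 : r ^ r ≤ (2 * r) ^ r / 4 := by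
    rw [Real.mul_rpow (by norm_num) r0.le]
    have : (2 : ℝ) ^ (2 : ℝ) ≤ 2 ^ r := Real.rpow_le_rpow_of_exponent_le (by norm_num) hr
    norm_num at this
    have h4 : 0 ≤ r ^ r := by positivity
    nlinarith
  have h5 : (n : ℝ) ^ (r / 2) + 3 / 4 * (n : ℝ) ^ (r / 2 - 1) + 1 / 4
      ≤ ((n + 1 : ℕ) : ℝ) ^ (r / 2) := by
    have hs : 0 ≤ r / 2 - 1 := by linarith
    have e1 := rpow_add_one_eq hs hn
    have e2 := rpow_add_one_eq hs (show (0 : ℝ) ≤ n + 1 by linarith)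
    rw [sub_add_cancel] at e1 e2
    push_cast
    rw [e1, e2]
    have l1 : (n : ℝ) ^ (r / 2 - 1) ≤ ((n : ℝ) + 1) ^ (r / 2 - 1) := by gcongr; linarith
    have l2 : 1 ≤ ((n : ℝ) + 1) ^ (r / 2 - 1) := Real.one_le_rpow (by linarith) hs
    nlinarith
  set K := (2 * r) ^ r
  have hK : 0 ≤ K := by positivity
  calc f + 3 * r ^ 2 * (f ^ ((r - 2) / r) * b ^ (2 / r)) + r ^ r * b
      ≤ K * (n : ℝ) ^ (r / 2) * b + 3 * r ^ 2 * ((2 * r) ^ (r - 2) * (n : ℝ) ^ (r / 2 - 1) * b)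
        + K / 4 * b := by gcongr
    _ = K * ((n : ℝ) ^ (r / 2) + 3 / 4 * (n : ℝ) ^ (r / 2 - 1) + 1 / 4) * b := by
        rw [h2]; ring
    _ ≤ _ := by gcongr

/-! ### Moment estimates for random variables -/

section Moments

variable {Ω : Type*} [MeasurableSpace Ω] {μ : Measure Ω} [IsProbabilityMeasure μ]

theorem integrable_rpow_of_le {f : Ω → ℝ} {q r : ℝ} (hf : AEMeasurable f μ)
    (hf0 : ∀ᵐ ω ∂μ, 0 ≤ f ω) (hq : 0 ≤ q) (hqr : q ≤ r)
    (hint : Integrable (fun ω => f ω ^ r) μ) : Integrable (fun ω => f ω ^ q) μ := by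
  refine ((integrable_const (1 : ℝ)).add hint).mono' (hf.pow_const q).aestronglyMeasurable ?_
  filter_upwards [hf0] with ω h0
  have h1 : 0 ≤ f ω ^ r := by positivity
  rw [Real.norm_of_nonneg (by positivity), Pi.add_apply]
  rcases le_total (f ω) 1 with h | h
  · linarith [Real.rpow_le_one h0 h hq]
  · linarith [Real.rpow_le_rpow_of_exponent_le h hqr]

/-- Lyapunov's inequality. -/
theorem integral_rpow_le_rpow_integral {f : Ω → ℝ} {q r : ℝ} (hf : AEMeasurable f μ)
    (hf0 : ∀ᵐ ω ∂μ, 0 ≤ f ω) (hr : 0 < r) (hq : 0 ≤ q) (hqr : q ≤ r)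
    (hint : Integrable (fun ω => f ω ^ r) μ) :
    ∫ ω, f ω ^ q ∂μ ≤ (∫ ω, f ω ^ r ∂μ) ^ (q / r) := by
  have hqr0 : 0 ≤ q / r := by positivity
  have hcomp : ∀ᵐ ω ∂μ, f ω ^ q = (f ω ^ r) ^ (q / r) := by
    filter_upwards [hf0] with ω h0
    rw [← Real.rpow_mul h0, mul_div_cancel₀ _ hr.ne']
  have hint' := integrable_rpow_of_le hf hf0 hq hqr hint
  rw [integral_congr_ae hcomp]
  refine ConcaveOn.le_map_integral (g := fun x : ℝ => x ^ (q / r))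
    (Real.concaveOn_rpow hqr0 ((div_le_one hr).2 hqr))
    (Real.continuous_rpow_const hqr0).continuousOn isClosed_Ici ?_ hint ?_
  · filter_upwards [hf0] with ω h0
    exact Real.rpow_nonneg h0 r
  · exact hint'.congr hcomp

/-- Growth of the `r`-th moment when a centred variable `Y`, predictably damped by `ξ`, is added to
a variable `U` such that `(U, ξ)` is independent of `Y`. -/
theorem integral_abs_add_mul_rpow_le {U ξ Y : Ω → ℝ} {r : ℝ} (hr : 2 ≤ r) (hU : Measurable U)
    (hξ : Measurable ξ) (hY : Measurable Y) (hξ1 : ∀ ω, |ξ ω| ≤ 1)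
    (hUr : Integrable (fun ω => |U ω| ^ r) μ) (hYr : Integrable (fun ω => |Y ω| ^ r) μ)
    (hYi : Integrable Y μ) (hY0 : ∫ ω, Y ω ∂μ = 0)
    (hind : IndepFun (fun ω => (U ω, ξ ω)) Y μ) :
    Integrable (fun ω => |U ω + ξ ω * Y ω| ^ r) μ ∧
    ∫ ω, |U ω + ξ ω * Y ω| ^ r ∂μ ≤ ∫ ω, |U ω| ^ r ∂μ
      + 3 * r ^ 2 * ((∫ ω, |U ω| ^ r ∂μ) ^ ((r - 2) / r) * (∫ ω, |Y ω| ^ r ∂μ) ^ (2 / r))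
      + r ^ r * ∫ ω, |Y ω| ^ r ∂μ := by
  have r0 : 0 < r := by linarith
  have hq : 0 ≤ r - 2 := by linarith
  set V : Ω → ℝ := fun ω => U ω * |U ω| ^ (r - 2) * ξ ω with hV
  have hVm : Measurable V := by fun_prop
  have hU1 : Integrable (fun ω => |U ω| ^ (r - 1)) μ :=
    integrable_rpow_of_le (by fun_prop) (.of_forall fun ω => abs_nonneg _) (by linarith)
      (by linarith) hUr
  have hU2 : Integrable (fun ω => |U ω| ^ (r - 2)) μ :=
    integrable_rpow_of_le (by fun_prop) (.of_forall fun ω => abs_nonneg _) (by linarith)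
      (by linarith) hUr
  have hY2 : Integrable (fun ω => |Y ω| ^ (2 : ℝ)) μ :=
    integrable_rpow_of_le (by fun_prop) (.of_forall fun ω => abs_nonneg _) (by linarith)
      (by linarith) hYr
  have hY2' : Integrable (fun ω => Y ω ^ 2) μ := by simpa using hY2
  have hVi : Integrable V μ := by
    refine hU1.mono' hVm.aestronglyMeasurable (.of_forall fun ω => ?_)
    have e := rpow_add_one_eq hq (abs_nonneg (U ω))
    rw [show r - 2 + 1 = r - 1 by ring] at e
    have h0 : 0 ≤ |U ω| ^ (r - 2) := by positivity
    rw [hV, Real.norm_eq_abs, abs_mul, abs_mul, abs_of_nonneg h0, e]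
    calc _ ≤ |U ω| * |U ω| ^ (r - 2) * 1 := by gcongr; exact hξ1 ω
      _ = _ := by ring
  have indV : IndepFun V Y μ :=
    hind.comp (φ := fun p : ℝ × ℝ => p.1 * |p.1| ^ (r - 2) * p.2) (ψ := id)
      (by fun_prop) measurable_id
  have indU : IndepFun (fun ω => |U ω| ^ (r - 2)) (fun ω => Y ω ^ 2) μ :=
    hind.comp (φ := fun p : ℝ × ℝ => |p.1| ^ (r - 2)) (ψ := fun y : ℝ => y ^ 2)
      (by fun_prop) (by fun_prop)
  have hVY : Integrable (fun ω => V ω * Y ω) μ := indV.integrable_mul hVi hYi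
  have hUY : Integrable (fun ω => |U ω| ^ (r - 2) * Y ω ^ 2) μ := indU.integrable_mul hU2 hY2'
  -- The first-order term vanishes: `V` depends only on `(U, ξ)`, and `Y` is centred and independent
  -- of it.
  have iVY : ∫ ω, V ω * Y ω ∂μ = 0 := by
    have := indV.integral_mul_eq_mul_integral hVm.aestronglyMeasurable hY.aestronglyMeasurable
    rw [hY0, mul_zero] at this
    exact this
  have iUY : ∫ ω, |U ω| ^ (r - 2) * Y ω ^ 2 ∂μ
      ≤ (∫ ω, |U ω| ^ r ∂μ) ^ ((r - 2) / r) * (∫ ω, |Y ω| ^ r ∂μ) ^ (2 / r) := by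
    have := indU.integral_mul_eq_mul_integral hU2.aestronglyMeasurable hY2'.aestronglyMeasurable
    simp only [Pi.mul_apply] at this
    rw [this]
    have h1 := integral_rpow_le_rpow_integral (μ := μ) (f := fun ω => |U ω|) (q := r - 2)
      (by fun_prop) (.of_forall fun ω => abs_nonneg _) r0 hq (by linarith) hUr
    have h2 := integral_rpow_le_rpow_integral (μ := μ) (f := fun ω => |Y ω|) (q := 2)
      (by fun_prop) (.of_forall fun ω => abs_nonneg _) r0 (by norm_num) (by linarith) hYr
    have h3 : ∫ ω, |Y ω| ^ (2 : ℝ) ∂μ = ∫ ω, Y ω ^ 2 ∂μ := by simp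
    rw [h3] at h2
    gcongr
  have hpt : ∀ ω, |U ω + ξ ω * Y ω| ^ r ≤ |U ω| ^ r + r * (V ω * Y ω)
      + 3 * r ^ 2 * (|U ω| ^ (r - 2) * Y ω ^ 2) + r ^ r * |Y ω| ^ r := by
    intro ω
    have h := abs_add_rpow_le hr (U ω) (ξ ω * Y ω)
    have h1 : (ξ ω * Y ω) ^ 2 ≤ Y ω ^ 2 := by
      rw [mul_pow]
      have : ξ ω ^ 2 ≤ 1 := by rw [sq_le_one_iff_abs_le_one]; exact hξ1 ω
      nlinarith [sq_nonneg (Y ω)]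
    have h2 : |ξ ω * Y ω| ^ r ≤ |Y ω| ^ r := by
      refine Real.rpow_le_rpow (abs_nonneg _) ?_ r0.le
      rw [abs_mul]
      nlinarith [abs_nonneg (Y ω), hξ1 ω]
    have h3 : 3 * r ^ 2 * (|U ω| ^ (r - 2) * (ξ ω * Y ω) ^ 2)
        ≤ 3 * r ^ 2 * (|U ω| ^ (r - 2) * Y ω ^ 2) := by gcongr
    have h4 : r ^ r * |ξ ω * Y ω| ^ r ≤ r ^ r * |Y ω| ^ r := by gcongr
    have h5 : r * (U ω * |U ω| ^ (r - 2)) * (ξ ω * Y ω) = r * (V ω * Y ω) := by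
      simp only [hV]; ring
    linarith
  have hsum₁ : Integrable (fun ω => |U ω| ^ r + r * (V ω * Y ω)) μ := hUr.add (hVY.const_mul _)
  have hsum₂ : Integrable (fun ω => |U ω| ^ r + r * (V ω * Y ω)
      + 3 * r ^ 2 * (|U ω| ^ (r - 2) * Y ω ^ 2)) μ := hsum₁.add (hUY.const_mul _)
  have hmaj : Integrable (fun ω => |U ω| ^ r + r * (V ω * Y ω)
      + 3 * r ^ 2 * (|U ω| ^ (r - 2) * Y ω ^ 2) + r ^ r * |Y ω| ^ r) μ :=
    hsum₂.add (hYr.const_mul _)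
  have hint : Integrable (fun ω => |U ω + ξ ω * Y ω| ^ r) μ := by
    refine hmaj.mono' (Measurable.aestronglyMeasurable (by fun_prop)) (.of_forall fun ω => ?_)
    rw [Real.norm_of_nonneg (by positivity)]
    exact hpt ω
  refine ⟨hint, (integral_mono hint hmaj hpt).trans ?_⟩
  rw [integral_add hsum₂ (hYr.const_mul _), integral_add hsum₁ (hUY.const_mul _),
    integral_add hUr (hVY.const_mul _), integral_const_mul, integral_const_mul,
    integral_const_mul, iVY, mul_zero, add_zero]
  gcongr

/-- Moments of a random variable with values in `ℕ` and an exponential tail. -/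
theorem lintegral_rpow_le_of_exp_tail {Z : Ω → ℕ} {A c r : ℝ} (hA : 0 ≤ A) (hc : 0 < c)
    (hr : 0 < r) (htail : ∀ n, 1 ≤ n → μ {ω | n ≤ Z ω} ≤ ENNReal.ofReal (A * Real.exp (-2 * c * n)))
    (hZ : AEMeasurable Z μ) :
    ∫⁻ ω, ENNReal.ofReal ((Z ω : ℝ) ^ r) ∂μ ≤ ENNReal.ofReal ((r / c) ^ r * (1 + A)) := by
  set δ := 1 - Real.exp (-c)
  have hec : Real.exp (-c) < 1 := by simpa using hc
  have hδ : 0 < δ := by simp only [δ]; linarith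
  -- Summation by parts for `exp (c * Z)`: `w n` is the increment of `exp (c * ·)` from `n` to `n +
  -- 1`. Against a tail of rate `2 * c` the series is geometric, and `δ` cancels its denominator.
  set w : ℕ → ℝ := fun n => Real.exp (c * (n + 1)) * δ with hw
  have hw0 : ∀ n, 0 ≤ w n := fun n => by positivity
  have htel : ∀ m : ℕ, Real.exp (c * m) = 1 + ∑ n ∈ Finset.range m, w n := by
    intro m
    induction m with
    | zero => simp
    | succ m ih =>
      rw [Finset.sum_range_succ, ← add_assoc, ← ih, hw]
      simp only [δ]
      rw [mul_sub, ← Real.exp_add]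
      push_cast
      rw [show c * ((m : ℝ) + 1) + -c = c * m by ring]
      ring
  have hnull : ∀ n : ℕ, NullMeasurableSet {ω | n ≤ Z ω} μ := fun n =>
    hZ.nullMeasurable (measurableSet_Ici (a := n))
  have hpt : ∀ ω, ENNReal.ofReal (Real.exp (c * Z ω)) ≤
      1 + ∑' n : ℕ, ({ω | n + 1 ≤ Z ω}).indicator (fun _ => ENNReal.ofReal (w n)) ω := by
    intro ω
    rw [htel, ENNReal.ofReal_add zero_le_one (Finset.sum_nonneg fun n _ => hw0 n),
      ENNReal.ofReal_one, ENNReal.ofReal_sum_of_nonneg fun n _ => hw0 n]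
    gcongr
    refine le_trans (Finset.sum_le_sum fun n hn => ?_) (ENNReal.sum_le_tsum (Finset.range (Z ω)))
    rw [Set.indicator_of_mem]
    exact Finset.mem_range.1 hn
  have hterm : ∀ n : ℕ, w n * (A * Real.exp (-2 * c * (n + 1 : ℕ)))
      = δ * A * Real.exp (-c) * Real.exp (-c) ^ n := by
    intro n
    rw [← Real.exp_nat_mul, hw]
    have : Real.exp (c * (n + 1)) * Real.exp (-2 * c * (n + 1 : ℕ))
        = Real.exp (-c) * Real.exp (n * -c) := by
      rw [← Real.exp_add, ← Real.exp_add]; congr 1; push_cast; ring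
    linear_combination (δ * A) * this
  have hsum : HasSum (fun n : ℕ => w n * (A * Real.exp (-2 * c * (n + 1 : ℕ))))
      (A * Real.exp (-c)) := by
    simp_rw [hterm]
    have h := (hasSum_geometric_of_lt_one (Real.exp_pos _).le hec).mul_left
      (δ * A * Real.exp (-c))
    rwa [show δ * A * Real.exp (-c) * (1 - Real.exp (-c))⁻¹ = A * Real.exp (-c) by
      change δ * A * Real.exp (-c) * δ⁻¹ = _
      field_simp] at h
  have hexp : ∫⁻ ω, ENNReal.ofReal (Real.exp (c * Z ω)) ∂μ ≤ ENNReal.ofReal (1 + A) := by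
    refine (lintegral_mono hpt).trans ?_
    rw [lintegral_add_left measurable_const, lintegral_tsum fun n =>
      (aemeasurable_const.indicator₀ (hnull (n + 1))), ENNReal.ofReal_add zero_le_one hA]
    simp only [lintegral_const, measure_univ, mul_one, ENNReal.ofReal_one]
    gcongr
    calc ∑' n : ℕ, ∫⁻ ω, ({ω | n + 1 ≤ Z ω}).indicator (fun _ => ENNReal.ofReal (w n)) ω ∂μ
        ≤ ∑' n : ℕ, ENNReal.ofReal (w n * (A * Real.exp (-2 * c * (n + 1 : ℕ)))) := by
          refine ENNReal.tsum_le_tsum fun n => ?_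
          rw [lintegral_indicator_const₀ (hnull (n + 1)), ENNReal.ofReal_mul (hw0 n)]
          gcongr
          exact htail (n + 1) (by omega)
      _ = ENNReal.ofReal (A * Real.exp (-c)) := by
          rw [← ENNReal.ofReal_tsum_of_nonneg _ hsum.summable, hsum.tsum_eq]
          intro n
          have := hw0 n
          positivity
      _ ≤ ENNReal.ofReal A := ENNReal.ofReal_le_ofReal (by nlinarith)
  calc ∫⁻ ω, ENNReal.ofReal ((Z ω : ℝ) ^ r) ∂μ
      ≤ ∫⁻ ω, ENNReal.ofReal ((r / c) ^ r) * ENNReal.ofReal (Real.exp (c * Z ω)) ∂μ := by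
        refine lintegral_mono fun ω => ?_
        rw [← ENNReal.ofReal_mul (by positivity)]
        exact ENNReal.ofReal_le_ofReal (rpow_le_mul_exp hr hc (Nat.cast_nonneg _))
    _ = ENNReal.ofReal ((r / c) ^ r) * ∫⁻ ω, ENNReal.ofReal (Real.exp (c * Z ω)) ∂μ :=
        lintegral_const_mul' _ _ ENNReal.ofReal_ne_top
    _ ≤ ENNReal.ofReal ((r / c) ^ r) * ENNReal.ofReal (1 + A) := by gcongr
    _ = _ := (ENNReal.ofReal_mul (by positivity)).symm

end Moments

theorem integrable_and_integral_le_of_lintegral {Ω : Type*} [MeasurableSpace Ω] {μ : Measure Ω}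
    {f : Ω → ℝ} {C : ℝ} (hf : AEStronglyMeasurable f μ)
    (hf0 : ∀ ω, 0 ≤ f ω) (hC : 0 ≤ C)
    (h : ∫⁻ ω, ENNReal.ofReal (f ω) ∂μ ≤ ENNReal.ofReal C) :
    Integrable f μ ∧ ∫ ω, f ω ∂μ ≤ C := by
  constructor
  · refine ⟨hf, ?_⟩
    rw [hasFiniteIntegral_iff_ofReal (.of_forall hf0)]
    exact h.trans_lt ENNReal.ofReal_lt_top
  · rw [integral_eq_lintegral_of_nonneg_ae (.of_forall hf0) hf]
    exact ENNReal.toReal_le_of_le_ofReal hC h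

/-! ### The stopped walk and the Chernoff bound -/

/-- The centred random walk `S_n - n`, frozen at the first passage of `S_n` above level `t`. -/
noncomputable def stoppedWalk {Ω : Type*} (X : ℕ → Ω → ℝ) (t : ℝ) (n : ℕ) (ω : Ω) : ℝ :=
  ∑ i ∈ Finset.range n, (if renewalEpoch X i ω ≤ t then 1 else 0) * (X i ω - 1)

section Walk

variable {Ω : Type*} {X : ℕ → Ω → ℝ}

/-- The σ-algebra is left arbitrary so that the one generated by `X 0, …, X (n - 1)` can be used for
independence. -/
theorem measurable_renewalEpoch {m : MeasurableSpace Ω} {n : ℕ}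
    (h : ∀ i < n, Measurable[m] (X i)) : Measurable[m] (renewalEpoch X n) := by
  unfold renewalEpoch
  exact Finset.measurable_fun_sum _ fun i hi => h i (Finset.mem_range.1 hi)

theorem measurable_passage {m : MeasurableSpace Ω} {n : ℕ} (t : ℝ)
    (h : ∀ i < n, Measurable[m] (X i)) :
    Measurable[m] (fun ω => if renewalEpoch X n ω ≤ t then (1 : ℝ) else 0) :=
  Measurable.ite (measurableSet_le (measurable_renewalEpoch h) measurable_const)
    measurable_const measurable_const

theorem measurable_stoppedWalk {m : MeasurableSpace Ω} {n : ℕ} (t : ℝ)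
    (h : ∀ i < n, Measurable[m] (X i)) : Measurable[m] (stoppedWalk X t n) := by
  unfold stoppedWalk
  refine Finset.measurable_fun_sum _ fun i hi => ?_
  have hi := Finset.mem_range.1 hi
  exact (measurable_passage t fun j hj => h j (hj.trans hi)).mul ((h i hi).sub_const 1)

/-- Whether step `n` is still active is decided by `S_n`, hence by `X 0, …, X (n - 1)` alone. -/
theorem indepFun_stoppedWalk [MeasurableSpace Ω] {μ : Measure Ω} (hX : ∀ i, Measurable (X i)) (hind : iIndepFun X μ)
    (t : ℝ) (n : ℕ) :
    IndepFun (fun ω => (stoppedWalk X t n ω,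
      if renewalEpoch X n ω ≤ t then (1 : ℝ) else 0)) (X n) μ := by
  have h := indep_iSup_of_disjoint (fun i => (hX i).comap_le) hind
    (S := Set.Iio n) (T := {n}) (by simp)
  rw [IndepFun_iff_Indep]
  refine indep_of_indep_of_le_left (indep_of_indep_of_le_right h ?_) ?_
  · simp
  · have hm : ∀ i < n, Measurable[⨆ i ∈ Set.Iio n, MeasurableSpace.comap (X i) inferInstance]
        (X i) := fun i hi =>
      (comap_measurable (X i)).mono (le_iSup₂_of_le i hi le_rfl) le_rfl
    exact ((measurable_stoppedWalk t hm).prodMk (measurable_passage t hm)).comap_le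

/-- The `r`-th moment of the stopped centred walk grows at most like `n ^ (r / 2)`. -/
theorem integral_stoppedWalk_rpow_le [MeasurableSpace Ω] {μ : Measure Ω} [IsProbabilityMeasure μ]
    (hX : ∀ i, Measurable (X i)) (hind : iIndepFun X μ) {r b : ℝ} (hr : 2 ≤ r) (t : ℝ)
    (hint : ∀ i, Integrable (X i) μ) (hmean : ∀ i, ∫ ω, X i ω ∂μ = 1)
    (hintr : ∀ i, Integrable (fun ω => |X i ω - 1| ^ r) μ)
    (hb : ∀ i, ∫ ω, |X i ω - 1| ^ r ∂μ ≤ b) (n : ℕ) :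
    Integrable (fun ω => |stoppedWalk X t n ω| ^ r) μ ∧
    ∫ ω, |stoppedWalk X t n ω| ^ r ∂μ ≤ (2 * r) ^ r * (n : ℝ) ^ (r / 2) * b := by
  have r0 : 0 < r := by linarith
  have hb' : ∀ i, 0 ≤ ∫ ω, |X i ω - 1| ^ r ∂μ := fun i => integral_nonneg fun ω => by positivity
  have hb0 : 0 ≤ b := (hb' 0).trans (hb 0)
  induction n with
  | zero =>
    simp [stoppedWalk, Real.zero_rpow r0.ne', Real.zero_rpow (show r / 2 ≠ 0 by positivity)]
  | succ n ih =>
    obtain ⟨ih1, ih2⟩ := ih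
    have hstep := integral_abs_add_mul_rpow_le (μ := μ) (U := stoppedWalk X t n)
      (ξ := fun ω => if renewalEpoch X n ω ≤ t then (1 : ℝ) else 0) (Y := fun ω => X n ω - 1)
      hr (measurable_stoppedWalk t fun i _ => hX i) (measurable_passage t fun i _ => hX i)
      ((hX n).sub_const 1) (fun ω => by split_ifs <;> simp) ih1 (hintr n)
      ((hint n).sub (integrable_const 1))
      (by rw [integral_sub (hint n) (integrable_const 1), hmean n]; simp)
      ((indepFun_stoppedWalk hX hind t n).comp measurable_id
        (measurable_id.sub_const (1 : ℝ)))
    have e : ∀ ω, stoppedWalk X t (n + 1) ω = stoppedWalk X t n ω +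
        (if renewalEpoch X n ω ≤ t then (1 : ℝ) else 0) * (X n ω - 1) := fun ω => by
      simp only [stoppedWalk, Finset.sum_range_succ]
    simp only [e]
    refine ⟨hstep.1, hstep.2.trans ?_⟩
    refine le_trans ?_ (moment_recursion_step hr n hb0
      (integral_nonneg fun ω => Real.rpow_nonneg (abs_nonneg (stoppedWalk X t n ω)) r) ih2)
    have := hb n
    have := hb' n
    have : 0 ≤ ∫ ω, |stoppedWalk X t n ω| ^ r ∂μ :=
      integral_nonneg fun ω => by positivity
    gcongr

theorem renewalEpoch_mono {ω : Ω} (h : ∀ i, 0 ≤ X i ω) : Monotone (fun n => renewalEpoch X n ω) :=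
  fun _ _ hmn => Finset.sum_le_sum_of_subset_of_nonneg (Finset.range_mono hmn) fun i _ _ => h i

/-- If exactly `N` renewals occur up to time `t`, then the deficit `t - N` is controlled by the
stopped walk at time `⌈t⌉`. -/
theorem sub_le_abs_stoppedWalk {ω : Ω} {t : ℝ} {N : ℕ}
    (hN : ∀ n, n ≤ N ↔ renewalEpoch X n ω ≤ t) :
    t - N ≤ |stoppedWalk X t ⌈t⌉₊ ω| + 1 := by
  rcases le_total t N with h | h
  · linarith [abs_nonneg (stoppedWalk X t ⌈t⌉₊ ω)]
  rcases eq_or_lt_of_le h with h | h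
  · linarith [abs_nonneg (stoppedWalk X t ⌈t⌉₊ ω)]
  have hlt : N + 1 ≤ ⌈t⌉₊ := Nat.lt_ceil.2 h
  -- Exactly the steps `0, …, N` are active; step `N` is the one that overshoots `t`.
  have e : stoppedWalk X t ⌈t⌉₊ ω = renewalEpoch X (N + 1) ω - (N + 1) := by
    unfold stoppedWalk
    rw [← Finset.sum_subset (Finset.range_mono hlt)]
    · rw [renewalEpoch, Finset.sum_congr rfl (g := fun i => X i ω - 1)]
      · simp
      · intro i hi
        rw [if_pos ((hN i).1 (by have := Finset.mem_range.1 hi; omega)), one_mul]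
    · intro i _ hi
      rw [if_neg (fun hc => hi (Finset.mem_range.2 (by have := (hN i).2 hc; omega))), zero_mul]
  have h1 : t < renewalEpoch X (N + 1) ω := by
    by_contra! hc
    have := (hN (N + 1)).2 hc
    omega
  rw [e]
  linarith [le_abs_self (renewalEpoch X (N + 1) ω - (N + 1))]

theorem measure_renewalEpoch_le [MeasurableSpace Ω] {μ : Measure Ω} [IsProbabilityMeasure μ]
    (hX : ∀ i, Measurable (X i)) (hind : iIndepFun X μ) (hnn : ∀ᵐ ω ∂μ, ∀ i, 0 ≤ X i ω)
    {α ψ : ℝ} (hα : 0 ≤ α) (hψ : ∀ i, ∫ ω, Real.exp (-α * X i ω) ∂μ ≤ Real.exp ψ)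
    (t : ℝ) (n : ℕ) :
    μ {ω | renewalEpoch X n ω ≤ t} ≤ ENNReal.ofReal (Real.exp (α * t + n * ψ)) := by
  have hSm : Measurable (renewalEpoch X n) := measurable_renewalEpoch fun i _ => hX i
  have hint : Integrable (fun ω => Real.exp (-α * renewalEpoch X n ω)) μ := by
    refine (integrable_const (1 : ℝ)).mono'
      (Measurable.aestronglyMeasurable (by fun_prop)) ?_
    filter_upwards [hnn] with ω h
    rw [Real.norm_of_nonneg (Real.exp_pos _).le, Real.exp_le_one_iff]
    have : 0 ≤ renewalEpoch X n ω := Finset.sum_nonneg fun i _ => h i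
    nlinarith
  have h := measure_le_le_exp_mul_mgf t (neg_nonpos.2 hα) hint
  have hmgf : mgf (renewalEpoch X n) μ (-α) ≤ Real.exp ψ ^ n := by
    have e : renewalEpoch X n = ∑ i ∈ Finset.range n, X i := by
      ext ω; simp [renewalEpoch]
    rw [e, hind.mgf_sum hX]
    calc ∏ i ∈ Finset.range n, mgf (X i) μ (-α) ≤ ∏ i ∈ Finset.range n, Real.exp ψ :=
          Finset.prod_le_prod (fun i _ => mgf_nonneg) fun i _ => hψ i
      _ = _ := by simp
  rw [← ofReal_measureReal]
  refine ENNReal.ofReal_le_ofReal (h.trans ?_)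
  rw [neg_neg, Real.exp_add, Real.exp_nat_mul]
  gcongr

end Walk

/-! ### The counting process and Laplace transform bounds -/

theorem renewalCount_spec {Ω : Type*} {X : ℕ → Ω → ℝ} {ω : Ω} {t : ℝ} (ht : 0 ≤ t)
    (h : ∀ i, 0 ≤ X i ω) (hex : ∃ n, t < renewalEpoch X n ω) :
    renewalCount X t ω ≠ ⊤ ∧
      ∀ n, n ≤ (renewalCount X t ω).toNat ↔ renewalEpoch X n ω ≤ t := by
  classical
  set m := Nat.find hex
  have hlt : ∀ n, renewalEpoch X n ω ≤ t ↔ n < m := by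
    intro n
    rw [Nat.lt_find_iff]
    simp only [not_lt]
    exact ⟨fun hn k hk => (renewalEpoch_mono h hk).trans hn, fun hn => hn n le_rfl⟩
  -- Since `S_0 = 0 ≤ t`, the subtraction `m - 1` below is not truncated.
  have hm : 0 < m := (hlt 0).1 (by simpa [renewalEpoch] using ht)
  have hcount : renewalCount X t ω = ((m - 1 : ℕ) : ℕ∞) := by
    have : {n : ℕ | 1 ≤ n ∧ renewalEpoch X n ω ≤ t} = (Finset.Ico 1 m : Finset ℕ) := by
      ext n; simp [hlt]
    rw [renewalCount, this, Set.encard_coe_eq_coe_finsetCard, Nat.card_Ico]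
  rw [hcount]
  refine ⟨ENat.natCast_ne_top _, fun n => ?_⟩
  rw [hlt, ENat.toNat_natCast]
  omega

/-- Concavity of `x ↦ x ^ (1 / t)`: it lies below its tangent line at `1`. -/
theorem integral_exp_neg_div_le {Ω : Type*} [MeasurableSpace Ω] {μ : Measure Ω}
    [IsProbabilityMeasure μ] {Y : Ω → ℝ} {θ t : ℝ} (ht : 1 ≤ t)
    (hint : Integrable (fun ω => Real.exp (-θ * Y ω)) μ) :
    ∫ ω, Real.exp (-(θ / t) * Y ω) ∂μ
      ≤ Real.exp (-((1 - ∫ ω, Real.exp (-θ * Y ω) ∂μ) / t)) := by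
  have t0 : 0 < t := by linarith
  have hpt : ∀ ω, Real.exp (-(θ / t) * Y ω) ≤ 1 / t * Real.exp (-θ * Y ω) + (1 - 1 / t) := by
    intro ω
    have h1 : 1 / t ≤ 1 := (div_le_one t0).2 ht
    have h := Real.geom_mean_le_arith_mean2_weighted (w₁ := 1 / t) (w₂ := 1 - 1 / t)
      (p₁ := Real.exp (-θ * Y ω)) (p₂ := 1) (by positivity) (by linarith) (Real.exp_pos _).le
      zero_le_one (by ring)
    rw [Real.one_rpow, mul_one, mul_one, ← Real.exp_mul] at h
    convert h using 2
    ring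
  have hmaj : Integrable (fun ω => 1 / t * Real.exp (-θ * Y ω) + (1 - 1 / t)) μ :=
    (hint.const_mul _).add (integrable_const _)
  calc ∫ ω, Real.exp (-(θ / t) * Y ω) ∂μ
      ≤ ∫ ω, (1 / t * Real.exp (-θ * Y ω) + (1 - 1 / t)) ∂μ :=
        integral_mono_of_nonneg (.of_forall fun ω => (Real.exp_pos _).le) hmaj (.of_forall hpt)
    _ = 1 - (1 - ∫ ω, Real.exp (-θ * Y ω) ∂μ) / t := by
        rw [integral_add (hint.const_mul _) (integrable_const _), integral_const_mul]
        simp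
        ring
    _ ≤ _ := Real.one_sub_le_exp_neg _

theorem integral_exp_neg_le_quadratic {Ω : Type*} [MeasurableSpace Ω] {μ : Measure Ω}
    [IsProbabilityMeasure μ] {Y : Ω → ℝ} {α v : ℝ} (hα : 0 ≤ α) (hY0 : ∀ᵐ ω ∂μ, 0 ≤ Y ω)
    (hint : Integrable Y μ) (hmean : ∫ ω, Y ω ∂μ = 1)
    (hint2 : Integrable (fun ω => Y ω ^ 2) μ) (hv : ∫ ω, Y ω ^ 2 ∂μ = v) :
    ∫ ω, Real.exp (-α * Y ω) ∂μ ≤ Real.exp (-α + α ^ 2 * v / 2) := by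
  have h1 : Integrable (fun ω => 1 - α * Y ω) μ := (integrable_const 1).sub (hint.const_mul α)
  have h2 : Integrable (fun ω => α ^ 2 / 2 * Y ω ^ 2) μ := hint2.const_mul _
  calc ∫ ω, Real.exp (-α * Y ω) ∂μ ≤ ∫ ω, ((1 - α * Y ω) + α ^ 2 / 2 * Y ω ^ 2) ∂μ := by
        refine integral_mono_of_nonneg (.of_forall fun ω => (Real.exp_pos _).le) (h1.add h2) ?_
        filter_upwards [hY0] with ω h0
        have := exp_neg_le_quadratic (mul_nonneg hα h0)
        rw [← neg_mul] at this
        linarith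
    _ = (-α + α ^ 2 * v / 2) + 1 := by
        rw [integral_add h1 h2, integral_sub (integrable_const 1) (hint.const_mul α),
          integral_const_mul, integral_const_mul, hmean, hv]
        simp
        ring
    _ ≤ _ := Real.add_one_le_exp _

/-- `N` is almost everywhere the limit of the partial sums of the indicators of `S_{n+1} ≤ t`. -/
theorem aemeasurable_of_forall_le_iff {Ω : Type*} [MeasurableSpace Ω] {μ : Measure Ω}
    {X : ℕ → Ω → ℝ} (hX : ∀ i, Measurable (X i)) {t : ℝ} {N : Ω → ℕ}
    (hN : ∀ᵐ ω ∂μ, ∀ n, n ≤ N ω ↔ renewalEpoch X n ω ≤ t) : AEMeasurable N μ := by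
  refine aemeasurable_of_tendsto_metrizable_ae Filter.atTop
    (f := fun k ω => ∑ n ∈ Finset.range k, if renewalEpoch X (n + 1) ω ≤ t then 1 else 0) ?_ ?_
  · intro k
    refine (Finset.measurable_fun_sum _ fun n _ => Measurable.ite ?_ measurable_const
      measurable_const).aemeasurable
    exact measurableSet_le (measurable_renewalEpoch fun i _ => hX i) measurable_const
  · filter_upwards [hN] with ω h
    refine tendsto_const_nhds.congr' ?_
    filter_upwards [Filter.eventually_ge_atTop (N ω)] with k hk
    simp only [← h, Finset.sum_boole, Nat.cast_id, Nat.succ_le_iff]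
    have : (Finset.range k).filter (fun n => n < N ω) = Finset.range (N ω) := by
      ext n; simp; omega
    rw [this, Finset.card_range]

/-! ### Moments of the excess and of the deficit -/

/-- Moments of the excess of the number of renewals over its asymptotic mean. -/
theorem lintegral_excess_rpow_le {Ω : Type*} [MeasurableSpace Ω] {μ : Measure Ω}
    [IsProbabilityMeasure μ] {X : ℕ → Ω → ℝ} (hX : ∀ i, Measurable (X i)) {t θ p v M r : ℝ}
    {N : Ω → ℕ} (hN : ∀ᵐ ω ∂μ, ∀ n, n ≤ N ω ↔ renewalEpoch X n ω ≤ t)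
    (ht : 1 ≤ t) (hθ : 0 ≤ θ) (hp : 0 < p) (hp1 : p ≤ 1) (hv : 1 ≤ v) (hr : 0 < r)
    (hvM : v ^ (r / 2) ≤ M)
    (hsmall : ∀ n : ℕ, μ {ω | renewalEpoch X n ω ≤ t}
      ≤ ENNReal.ofReal (Real.exp (θ / t * t + n * -(p / t))))
    (hlarge : ∀ α : ℝ, 0 ≤ α → ∀ n : ℕ, μ {ω | renewalEpoch X n ω ≤ t}
      ≤ ENNReal.ofReal (Real.exp (α * t + n * (-α + α ^ 2 * v / 2)))) :
    ∫⁻ ω, ENNReal.ofReal ((max ((N ω : ℝ) - t) 0) ^ r) ∂μ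
      ≤ ENNReal.ofReal (4 * Real.exp θ * (4 * r / p) ^ r * (M * t ^ (r / 2))) := by
  have t0 : 0 < t := by linarith
  have v0 : 0 < v := by linarith
  have hNm := aemeasurable_of_forall_le_iff hX hN
  have hθ1 : 1 ≤ Real.exp θ := Real.one_le_exp hθ
  have hM : 0 ≤ M := le_trans (by positivity) hvM
  have hevent : ∀ n, μ {ω | n ≤ N ω} = μ {ω | renewalEpoch X n ω ≤ t} := fun n =>
    measure_congr <| by
      filter_upwards [hN] with ω h
      exact propext (h n)
  rcases le_total t v with htv | htv
  · have hbound := lintegral_rpow_le_of_exp_tail (μ := μ) (Z := N) (A := Real.exp θ)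
      (c := p / (2 * t)) (r := r) (by positivity) (by positivity) hr
      (fun n _ => by
        rw [hevent]
        refine (hsmall n).trans_eq ?_
        rw [← Real.exp_add]
        congr 2
        field_simp) hNm
    refine (lintegral_mono fun ω => ?_).trans (hbound.trans (ENNReal.ofReal_le_ofReal ?_))
    · refine ENNReal.ofReal_le_ofReal (Real.rpow_le_rpow (le_max_right _ _) ?_ hr.le)
      exact max_le (by linarith) (Nat.cast_nonneg _)
    · have htr : t ^ r ≤ M * t ^ (r / 2) := by
        have : t ^ r = t ^ (r / 2) * t ^ (r / 2) := by
          rw [← Real.rpow_add t0]; congr 1; ring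
        rw [this]
        gcongr
        exact le_trans (by gcongr) hvM
      calc (r / (p / (2 * t))) ^ r * (1 + Real.exp θ)
          = (2 * r / p) ^ r * t ^ r * (1 + Real.exp θ) := by
            rw [← Real.mul_rpow (by positivity) t0.le]
            congr 2
            field_simp
        _ ≤ (4 * r / p) ^ r * (M * t ^ (r / 2)) * (4 * Real.exp θ) := by
            gcongr
            · norm_num
            · linarith
        _ = _ := by ring
  · set s := Real.sqrt (v * t) with hs
    have hs1 : 1 ≤ s := Real.one_le_sqrt.2 (by nlinarith)
    have s0 : 0 < s := by linarith
    have hss : s ^ 2 = v * t := Real.sq_sqrt (by positivity)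
    have hvs : v ≤ s := Real.le_sqrt_of_sq_le (by nlinarith)
    -- Chernoff with `α = 1 / s`, `s = √(v * t)`. For `x = n + ⌊t⌋ - t ≥ 0` the exponent is at most
    -- `1/2 - x / (2 * s)`, using `v ≤ s`; rounding `t` down costs at most another `1/2`, whence `A
    -- = exp 1`.
    have hbound := lintegral_rpow_le_of_exp_tail (μ := μ) (Z := fun ω => N ω - ⌊t⌋₊)
      (A := Real.exp 1) (c := 1 / (4 * s)) (r := r) (by positivity) (by positivity) hr
      (fun n hn => by
        have e : {ω | n ≤ N ω - ⌊t⌋₊} = {ω | n + ⌊t⌋₊ ≤ N ω} := by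
          ext ω; simp only [Set.mem_ofPred_eq]; omega
        rw [e, hevent]
        refine (hlarge (1 / s) (by positivity) (n + ⌊t⌋₊)).trans (ENNReal.ofReal_le_ofReal ?_)
        rw [← Real.exp_add, Real.exp_le_exp]
        push_cast
        have hn1 : (1 : ℝ) ≤ n := by exact_mod_cast hn
        have hfl : t < ⌊t⌋₊ + 1 := Nat.lt_floor_add_one t
        have hfl' : (⌊t⌋₊ : ℝ) ≤ t := Nat.floor_le t0.le
        generalize (⌊t⌋₊ : ℝ) = f at *
        have hx0 : 0 ≤ (n : ℝ) + f - t := by linarith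
        have e1 : (1 / s) ^ 2 * v * t = 1 := by
          rw [div_pow, hss]; field_simp
        have e2 : (1 / s) ^ 2 * v ≤ 1 / s := by
          rw [div_pow, one_pow, one_div_mul_eq_div, div_le_div_iff₀ (by positivity) s0]
          nlinarith
        have e3 : 1 / s ≤ 1 := (div_le_one s0).2 hs1
        have e4 : -2 * (1 / (4 * s)) * (n : ℝ) = -(1 / s * n / 2) := by field_simp; ring
        rw [e4]
        have e5 := mul_le_mul_of_nonneg_left e2 hx0
        have e6 : 1 / s * (t - f) ≤ 1 := by
          have : 0 ≤ 1 / s := by positivity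
          nlinarith
        nlinarith) (hNm.sub_const _)
    refine (lintegral_mono fun ω => ?_).trans (hbound.trans (ENNReal.ofReal_le_ofReal ?_))
    · refine ENNReal.ofReal_le_ofReal (Real.rpow_le_rpow (le_max_right _ _) ?_ hr.le)
      refine max_le ?_ (Nat.cast_nonneg _)
      have h1 : (N ω : ℝ) ≤ ((N ω - ⌊t⌋₊ : ℕ) : ℝ) + (⌊t⌋₊ : ℝ) := by
        exact_mod_cast (by omega : N ω ≤ (N ω - ⌊t⌋₊) + ⌊t⌋₊)
      linarith [Nat.floor_le t0.le]
    · have hsr : s ^ r ≤ M * t ^ (r / 2) := by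
        rw [hs, Real.sqrt_eq_rpow, ← Real.rpow_mul (by positivity),
          show 1 / 2 * r = r / 2 by ring, Real.mul_rpow v0.le t0.le]
        gcongr
      calc (r / (1 / (4 * s))) ^ r * (1 + Real.exp 1)
          = (4 * r) ^ r * s ^ r * (1 + Real.exp 1) := by
            rw [← Real.mul_rpow (by positivity) s0.le]
            congr 2
            field_simp
        _ ≤ (4 * r / p) ^ r * (M * t ^ (r / 2)) * (4 * Real.exp θ) := by
            gcongr
            · rw [le_div_iff₀ hp]; nlinarith
            · linarith [Real.exp_one_lt_d9]
        _ = _ := by ring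

/-- Moments of the deficit are controlled by those of the stopped walk. -/
theorem lintegral_stoppedWalk_add_one_rpow_le {Ω : Type*} [MeasurableSpace Ω] {μ : Measure Ω}
    [IsProbabilityMeasure μ] {X : ℕ → Ω → ℝ} (hX : ∀ i, Measurable (X i))
    (hind : iIndepFun X μ) {r M t : ℝ} (hr : 2 ≤ r) (hM : 1 ≤ M) (ht : 1 ≤ t)
    (hint : ∀ i, Integrable (X i) μ) (hmean : ∀ i, ∫ ω, X i ω ∂μ = 1)
    (hnn : ∀ i, ∀ᵐ ω ∂μ, 0 ≤ X i ω)
    (hintr : ∀ i, Integrable (fun ω => X i ω ^ r) μ) (hMi : ∀ i, ∫ ω, X i ω ^ r ∂μ = M) :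
    ∫⁻ ω, ENNReal.ofReal ((|stoppedWalk X t ⌈t⌉₊ ω| + 1) ^ r) ∂μ
      ≤ ENNReal.ofReal (3 * (8 * r) ^ r * (M * t ^ (r / 2))) := by
  have r0 : 0 < r := by linarith
  have t0 : 0 < t := by linarith
  have hptw : ∀ i, ∀ᵐ ω ∂μ, |X i ω - 1| ^ r ≤ X i ω ^ r + 1 := fun i => by
    filter_upwards [hnn i] with ω h
    exact abs_sub_one_rpow_le r0.le h
  have hmaj : ∀ i, Integrable (fun ω => X i ω ^ r + 1) μ := fun i =>
    (hintr i).add (integrable_const 1)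
  have hcr : ∀ i, Integrable (fun ω => |X i ω - 1| ^ r) μ := fun i => by
    refine (hmaj i).mono' (Measurable.aestronglyMeasurable ?_) ?_
    · have := hX i
      fun_prop
    · filter_upwards [hptw i] with ω h
      rwa [Real.norm_of_nonneg (by positivity)]
  have hb : ∀ i, ∫ ω, |X i ω - 1| ^ r ∂μ ≤ 2 * M := fun i => by
    refine (integral_mono_ae (hcr i) (hmaj i) (hptw i)).trans ?_
    rw [integral_add (hintr i) (integrable_const 1), hMi i]
    simp
    linarith
  obtain ⟨hT, hTle⟩ := integral_stoppedWalk_rpow_le hX hind hr t hint hmean hcr hb ⌈t⌉₊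
  have hTint : Integrable (fun ω => 2 ^ r * (|stoppedWalk X t ⌈t⌉₊ ω| ^ r + 1)) μ :=
    (hT.add (integrable_const 1)).const_mul _
  calc ∫⁻ ω, ENNReal.ofReal ((|stoppedWalk X t ⌈t⌉₊ ω| + 1) ^ r) ∂μ
      ≤ ∫⁻ ω, ENNReal.ofReal (2 ^ r * (|stoppedWalk X t ⌈t⌉₊ ω| ^ r + 1)) ∂μ :=
        lintegral_mono fun ω => ENNReal.ofReal_le_ofReal (add_one_rpow_le r0.le (abs_nonneg _))
    _ = ENNReal.ofReal (∫ ω, 2 ^ r * (|stoppedWalk X t ⌈t⌉₊ ω| ^ r + 1) ∂μ) :=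
        (ofReal_integral_eq_lintegral_ofReal hTint (.of_forall fun ω => by positivity)).symm
    _ ≤ _ := ENNReal.ofReal_le_ofReal ?_
  rw [integral_const_mul, integral_add hT (integrable_const 1)]
  simp only [integral_const, probReal_univ, smul_eq_mul, mul_one]
  have hceil : (⌈t⌉₊ : ℝ) ^ (r / 2) ≤ 2 ^ r * t ^ (r / 2) := by
    calc (⌈t⌉₊ : ℝ) ^ (r / 2) ≤ (2 * t) ^ (r / 2) := by
          gcongr
          linarith [Nat.ceil_lt_add_one t0.le]
      _ = 2 ^ (r / 2) * t ^ (r / 2) := Real.mul_rpow (by norm_num) t0.le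
      _ ≤ _ := by
          gcongr
          · norm_num
          · linarith
  have h8 : (8 * r) ^ r = 2 ^ r * (2 ^ r * (2 * r) ^ r) := by
    rw [← Real.mul_rpow (by norm_num) (by positivity), ← Real.mul_rpow (by norm_num) (by positivity)]
    congr 1; ring
  have hone : 1 ≤ 2 ^ r * (2 * r) ^ r * (M * t ^ (r / 2)) := by
    have a1 : (1 : ℝ) ≤ 2 ^ r := Real.one_le_rpow (by norm_num) r0.le
    have a2 : 1 ≤ (2 * r) ^ r := Real.one_le_rpow (by linarith) r0.le
    have a3 : 1 ≤ t ^ (r / 2) := Real.one_le_rpow ht (by positivity)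
    exact one_le_mul_of_one_le_of_one_le (one_le_mul_of_one_le_of_one_le a1 a2)
      (one_le_mul_of_one_le_of_one_le hM a3)
  -- The factor `3` is `2 + 1`: `2 * M` bounds the centred moment, and the added `1` is absorbed by
  -- `hone`.
  calc 2 ^ r * (∫ ω, |stoppedWalk X t ⌈t⌉₊ ω| ^ r ∂μ + 1)
      ≤ 2 ^ r * ((2 * r) ^ r * (2 ^ r * t ^ (r / 2)) * (2 * M)
        + 2 ^ r * (2 * r) ^ r * (M * t ^ (r / 2))) := by
        gcongr
        exact hTle.trans (by gcongr)
    _ = _ := by rw [h8]; ring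

end Renewal

/-! ### Assembling the bound -/

open Renewal in
theorem lemma7 {Ω Ω' : Type*} [MeasurableSpace Ω] [MeasurableSpace Ω']
    (μ : Measure Ω) [IsProbabilityMeasure μ] (ν : Measure Ω') [IsProbabilityMeasure ν]
    (X : ℕ → Ω → ℝ) (S : Ω' → ℝ) (hX : IsOrdinaryRenewal X μ S ν)
    (hmean : ∫ ω, S ω ∂ν = 1)
    (r : ℝ) (hr : 2 ≤ r) (hmom : Integrable (fun ω => S ω ^ r) ν)
    (t : ℝ) (ht : 1 ≤ t) (θ : ℝ) (hθ : 0 < θ) :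
    (∀ᵐ ω ∂μ, renewalCount X t ω ≠ ⊤) ∧
    Integrable (fun ω => |((renewalCount X t ω).toNat : ℝ) - t| ^ r) μ ∧
    ∫ ω, |((renewalCount X t ω).toNat : ℝ) - t| ^ r ∂μ ≤
      Real.exp θ * (∫ ω, S ω ^ r ∂ν) *
        (10 ^ 5 * r ^ 2 / (1 - ∫ ω, Real.exp (-θ * S ω) ∂ν)) ^ (r + 1) * t ^ (r / 2) := by
  have r0 : 0 < r := by linarith
  have t0 : 0 < t := by linarith
  obtain ⟨hXm, hind, hid, hS0⟩ := hX
  have hSm : AEMeasurable S ν := (hid 0).aemeasurable_snd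
  -- A non-integrable `S` would have Bochner integral `0`, not `1`.
  have hSi : Integrable S ν := by
    by_contra h
    rw [integral_undef h] at hmean
    exact zero_ne_one hmean
  set M := ∫ ω, S ω ^ r ∂ν with hMdef
  set v := ∫ ω, S ω ^ 2 ∂ν with hvdef
  set p := 1 - ∫ ω, Real.exp (-θ * S ω) ∂ν with hpdef
  have hM0 : 0 ≤ M := integral_nonneg_of_ae <| by
    filter_upwards [hS0] with ω h using Real.rpow_nonneg h r
  have hS2 : Integrable (fun ω => S ω ^ 2) ν := by
    simpa using integrable_rpow_of_le hSm hS0 (by norm_num : (0 : ℝ) ≤ 2) hr hmom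
  have hM1 : 1 ≤ M := by
    have h := integral_rpow_le_rpow_integral hSm hS0 r0 zero_le_one (by linarith) hmom
    simp only [Real.rpow_one, hmean] at h
    by_contra! hlt
    exact absurd h (not_le.2 (Real.rpow_lt_one hM0 hlt (by positivity)))
  have hvM : v ^ (r / 2) ≤ M := by
    have h := integral_rpow_le_rpow_integral hSm hS0 r0 (by norm_num : (0 : ℝ) ≤ 2) hr hmom
    simp only [Real.rpow_ofNat] at h
    calc v ^ (r / 2) ≤ (M ^ (2 / r)) ^ (r / 2) := by
          refine Real.rpow_le_rpow (integral_nonneg fun ω => sq_nonneg _) h (by positivity)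
      _ = M := by
          rw [← Real.rpow_mul hM0, show 2 / r * (r / 2) = 1 by field_simp, Real.rpow_one]
  have hv1 : 1 ≤ v := by
    have h := integral_mono (μ := ν) ((hSi.const_mul 2).sub (integrable_const (1 : ℝ))) hS2
      (fun ω => by simp only [Pi.sub_apply]; nlinarith [sq_nonneg (S ω - 1)])
    simp only [Pi.sub_apply] at h
    rw [integral_sub (hSi.const_mul 2) (integrable_const _), integral_const_mul, hmean] at h
    norm_num at h
    exact h
  have hEle : ∀ᵐ ω ∂ν, Real.exp (-θ * S ω) ≤ 1 := by
    filter_upwards [hS0] with ω h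
    rw [Real.exp_le_one_iff]
    nlinarith
  have hEint : Integrable (fun ω => Real.exp (-θ * S ω)) ν := by
    refine (integrable_const (1 : ℝ)).mono'
      (hSm.const_mul (-θ)).exp.aestronglyMeasurable ?_
    filter_upwards [hEle] with ω h
    rwa [Real.norm_of_nonneg (Real.exp_pos _).le]
  have hp1 : p ≤ 1 := by
    have : 0 ≤ ∫ ω, Real.exp (-θ * S ω) ∂ν := integral_nonneg fun ω => (Real.exp_pos _).le
    linarith
  -- If `p = 0`, then `S = 0` almost surely, against mean `1`.
  have hp0 : 0 < p := by
    have hpeq : p = ∫ ω, (1 - Real.exp (-θ * S ω)) ∂ν := by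
      rw [integral_sub (integrable_const _) hEint]; simp [hpdef]
    have hnn : 0 ≤ᵐ[ν] fun ω => 1 - Real.exp (-θ * S ω) := by
      filter_upwards [hEle] with ω h
      simpa using h
    refine lt_of_le_of_ne (hpeq ▸ integral_nonneg_of_ae hnn) fun h0 => ?_
    rw [hpeq, eq_comm, integral_eq_zero_iff_of_nonneg_ae hnn ((integrable_const _).sub hEint)] at h0
    have : S =ᵐ[ν] 0 := by
      filter_upwards [h0] with ω h
      have h : Real.exp (-θ * S ω) = 1 := by simp only [Pi.zero_apply] at h; linarith
      rw [Real.exp_eq_one_iff] at h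
      simpa [hθ.ne'] using h
    rw [integral_congr_ae this] at hmean
    simp at hmean
  have hnn : ∀ i, ∀ᵐ ω ∂μ, 0 ≤ X i ω := fun i =>
    (hid i).symm.ae_mem_snd measurableSet_Ici hS0
  have hnn' : ∀ᵐ ω ∂μ, ∀ i, 0 ≤ X i ω := ae_all_iff.2 hnn
  have hXi : ∀ i, Integrable (X i) μ := fun i => (hid i).integrable_iff.2 hSi
  have hXmean : ∀ i, ∫ ω, X i ω ∂μ = 1 := fun i => (hid i).integral_eq.trans hmean
  have hpow : ∀ i, IdentDistrib (fun ω => X i ω ^ r) (fun ω => S ω ^ r) μ ν := fun i =>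
    (hid i).comp (u := fun x : ℝ => x ^ r) (by fun_prop)
  have hsq : ∀ i, IdentDistrib (fun ω => X i ω ^ 2) (fun ω => S ω ^ 2) μ ν := fun i =>
    (hid i).comp (u := fun x : ℝ => x ^ 2) (by fun_prop)
  have hexp : ∀ i, IdentDistrib (fun ω => Real.exp (-θ * X i ω))
      (fun ω => Real.exp (-θ * S ω)) μ ν := fun i =>
    (hid i).comp (u := fun x : ℝ => Real.exp (-θ * x)) (by fun_prop)
  have hsmall : ∀ n : ℕ, μ {ω | renewalEpoch X n ω ≤ t}
      ≤ ENNReal.ofReal (Real.exp (θ / t * t + n * -(p / t))) := by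
    refine measure_renewalEpoch_le hXm hind hnn' (by positivity) (fun i => ?_) t
    have := integral_exp_neg_div_le (μ := μ) (Y := X i) (θ := θ) ht
      ((hexp i).integrable_iff.2 hEint)
    rwa [(hexp i).integral_eq] at this
  have hlarge : ∀ α : ℝ, 0 ≤ α → ∀ n : ℕ, μ {ω | renewalEpoch X n ω ≤ t}
      ≤ ENNReal.ofReal (Real.exp (α * t + n * (-α + α ^ 2 * v / 2))) := fun α hα =>
    measure_renewalEpoch_le hXm hind hnn' hα (fun i => integral_exp_neg_le_quadratic hα (hnn i)
      (hXi i) (hXmean i) ((hsq i).integrable_iff.2 hS2) (hsq i).integral_eq) t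
  have hex : ∀ᵐ ω ∂μ, ∃ n, t < renewalEpoch X n ω := by
    rw [ae_iff]
    simp only [not_exists, not_lt]
    have hsub : ∀ n, {ω | ∀ k, renewalEpoch X k ω ≤ t} ⊆ {ω | renewalEpoch X n ω ≤ t} :=
      fun n ω (h : ∀ k, renewalEpoch X k ω ≤ t) => h n
    refine le_antisymm (ge_of_tendsto' (f := fun n : ℕ =>
      ENNReal.ofReal (Real.exp (θ / t * t + n * -(p / t)))) (x := Filter.atTop) ?_ fun n =>
      (measure_mono (hsub n)).trans (hsmall n)) zero_le
    rw [← ENNReal.ofReal_zero]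
    refine (ENNReal.continuous_ofReal.tendsto 0).comp (Real.tendsto_exp_atBot.comp ?_)
    refine Filter.tendsto_atBot_add_const_left _ _ ?_
    exact tendsto_natCast_atTop_atTop.atTop_mul_const_of_neg (neg_neg_of_pos (by positivity))
  have hspec : ∀ᵐ ω ∂μ, renewalCount X t ω ≠ ⊤ ∧
      ∀ n, n ≤ (renewalCount X t ω).toNat ↔ renewalEpoch X n ω ≤ t := by
    filter_upwards [hnn', hex] with ω h1 h2 using renewalCount_spec t0.le h1 h2
  have hN : ∀ᵐ ω ∂μ, ∀ n, n ≤ (renewalCount X t ω).toNat ↔ renewalEpoch X n ω ≤ t :=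
    hspec.mono fun ω h => h.2
  have hNm := aemeasurable_of_forall_le_iff hXm hN
  refine ⟨hspec.mono fun ω h => h.1, ?_⟩
  have hNr : AEMeasurable (fun ω => ((renewalCount X t ω).toNat : ℝ)) μ :=
    measurable_from_top.comp_aemeasurable hNm
  refine integrable_and_integral_le_of_lintegral
    ((hNr.sub_const t).abs.pow_const r).aestronglyMeasurable (fun ω => by positivity)
    (by positivity) ?_
  have hup := lintegral_excess_rpow_le hXm hN ht hθ.le hp0 hp1 hv1 r0 hvM hsmall hlarge
  have hlow := lintegral_stoppedWalk_add_one_rpow_le hXm hind hr hM1 ht hXi hXmean hnn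
    (fun i => (hpow i).integrable_iff.2 hmom) fun i => (hpow i).integral_eq
  have hsplit : ∀ᵐ ω ∂μ, ENNReal.ofReal (|((renewalCount X t ω).toNat : ℝ) - t| ^ r) ≤
      ENNReal.ofReal ((|stoppedWalk X t ⌈t⌉₊ ω| + 1) ^ r) +
      ENNReal.ofReal ((max (((renewalCount X t ω).toNat : ℝ) - t) 0) ^ r) := by
    filter_upwards [hN] with ω h
    have hd := sub_le_abs_stoppedWalk h
    rcases le_total (((renewalCount X t ω).toNat : ℝ) - t) 0 with h0 | h0
    · refine le_add_right (ENNReal.ofReal_le_ofReal (Real.rpow_le_rpow (abs_nonneg _) ?_ r0.le))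
      rw [abs_of_nonpos h0]
      linarith
    · rw [abs_of_nonneg h0, max_eq_left h0]
      exact le_add_left le_rfl
  have hTm : Measurable fun ω => ENNReal.ofReal ((|stoppedWalk X t ⌈t⌉₊ ω| + 1) ^ r) := by
    have : Measurable (stoppedWalk X t ⌈t⌉₊) := measurable_stoppedWalk t fun i _ => hXm i
    fun_prop
  refine (lintegral_mono_ae hsplit).trans ?_
  rw [lintegral_add_left hTm]
  refine (add_le_add hlow hup).trans ?_
  rw [← ENNReal.ofReal_add (by positivity) (by positivity)]
  refine ENNReal.ofReal_le_ofReal ?_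
  set D := 10 ^ 5 * r ^ 2 / p with hD
  have hDr : 10 ^ 5 * r ^ 2 ≤ D := by
    rw [hD, le_div_iff₀ hp0]
    exact mul_le_of_le_one_right (by positivity) hp1
  -- The extra power of `D` in the exponent `r + 1` absorbs `7 = 3 + 4`, the sum of the two
  -- numerical constants.
  have hD7 : 7 ≤ D := le_trans (by nlinarith) hDr
  have h8 : (8 * r) ^ r ≤ D ^ r := by
    refine Real.rpow_le_rpow (by positivity) (le_trans ?_ hDr) r0.le
    nlinarith
  have h4 : (4 * r / p) ^ r ≤ D ^ r := by
    refine Real.rpow_le_rpow (by positivity) ?_ r0.le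
    rw [hD]
    refine div_le_div_of_nonneg_right ?_ hp0.le
    nlinarith
  have hθ1 : 1 ≤ Real.exp θ := Real.one_le_exp hθ.le
  rw [rpow_add_one_eq r0.le (by linarith)]
  calc 3 * (8 * r) ^ r * (M * t ^ (r / 2))
        + 4 * Real.exp θ * (4 * r / p) ^ r * (M * t ^ (r / 2))
      ≤ (3 * Real.exp θ) * D ^ r * (M * t ^ (r / 2))
        + 4 * Real.exp θ * D ^ r * (M * t ^ (r / 2)) := by
        gcongr
        linarith
    _ = Real.exp θ * M * (D ^ r * 7) * t ^ (r / 2) := by ring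
    _ ≤ _ := by gcongr
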